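/- Theorem. Let $X$ be a real random variable with $\mathbb{E}[|X|^\kappa]<\infty$ for some $\kappa>0$, and let $X_1,X_2,\dots$ be independent random variables, each with the distribution of $X$. Let $F_X$ be the distribution function of $X$ and $F_X^{-1}(t)=\inf\{x\in\mathbb{R}: F_X(x)\ge t\}$, $0<t<1$, its quantile function; for each $n\ge 1$ let $X_{1:n}\le X_{2:n}\le\dots\le X_{n:n}$ be the order statistics of $X_1,\dots,X_n$. Let $J^*:(0,1)\to\mathbb{R}$ be continuous almost everywhere (with respect to Lebesgue measure) and suppose that, for some $\gamma>0$ and $M^*>0$, $$|J^*(t)|\le M^*[t(1-t)]^{-1+\frac1\kappa+\gamma},\qquad 0<t<1 .$$ Then the function $J^*F_X^{-1}$ is integrable on $(0,1)$, and $$\frac1n\sum_{i=1}^n J^*\!\left(\frac{i}{n+1}\right)X_{i:n}\ \longrightarrow\ \int_0^1 J^*(t)F_X^{-1}(t)\,\mathrm{d}t\qquad\text{almost surely, as } n\to\infty .$$ -/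

import Mathlib

open MeasureTheory ProbabilityTheory Filter Set
open scoped Topology

/-- The quantile function of a probability measure `ν` on `ℝ` with distribution function
`F = cdf ν`: for `0 < t < 1`, `F⁻¹(t) = inf {x : F(x) ≥ t}`. -/
noncomputable def quantileFn (ν : Measure ℝ) (t : ℝ) : ℝ :=
  sInf {x : ℝ | t ≤ cdf ν x}

/-- The order statistics of a sample `x` of size `n`: the values in nondecreasing order. Indices
start at `0`, so `orderStat x i` is the `(i + 1)`-th smallest value, `x_{i+1:n}`. -/
noncomputable def orderStat {n : ℕ} (x : Fin n → ℝ) (i : Fin n) : ℝ :=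
  x (Tuple.sort x i)

/-- The L-statistic `(1/n) ∑_{i=1}^n J(i/(n+1)) x_{i:n}` of the sample consisting of the first `n`
terms of the sequence `x`; the summation index of the code is `i - 1`. -/
noncomputable def lStatistic (J : ℝ → ℝ) (x : ℕ → ℝ) (n : ℕ) : ℝ :=
  (1 / (n : ℝ)) * ∑ i : Fin n,
    J (((i : ℕ) + 1 : ℝ) / ((n : ℝ) + 1)) * orderStat (fun j : Fin n => x j) i

/-! The L-statistic is the integral over $(0,1)$ of the step function $t\mapsto J(u)\,x_{\lfloor
nt\rfloor+1:n}$ with $u=(\lfloor nt\rfloor+1)/(n+1)$, so dominated convergence applies on almost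
every sample path. Pointwise limit: $u\to t$, and the strong law at rational points makes empirical
quantiles converge wherever the quantile function is continuous (`tendsto_orderStat_quantileFn`).
Domination: the empirical $\kappa$-th moments are bounded by some $C$, so a Markov bound
(`abs_orderStat_rpow_mul_le`) gives $|x_{i:n}|\le (C/(u(1-u)))^{1/\kappa}$. Against the bound on $J$
this leaves $[u(1-u)]^{-1+\gamma}$, and $u(1-u)\ge t(1-t)/4$ makes the majorant independent of $n$.
-/

/-! ### Order statistics of a finite sample -/

theorem orderStat_monotone {n : ℕ} (x : Fin n → ℝ) : Monotone (orderStat x) :=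
  Tuple.monotone_sort x

theorem sum_comp_orderStat {n : ℕ} (x : Fin n → ℝ) (f : ℝ → ℝ) :
    ∑ i, f (orderStat x i) = ∑ i, f (x i) :=
  Equiv.sum_comp (Tuple.sort x) (fun i => f (x i))

/-- The `(i + 1)`-th smallest value is at most `q` iff more than `i` of the values are. -/
theorem orderStat_le_iff {n : ℕ} (x : Fin n → ℝ) (i : Fin n) (q : ℝ) :
    orderStat x i ≤ q ↔ ((i : ℕ) : ℝ) < ∑ j, (Iic q).indicator (fun _ => (1 : ℝ)) (x j) := by
  classical
  have hsum : ∑ j, (Iic q).indicator (fun _ => (1 : ℝ)) (x j) =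
      ((Finset.univ.filter fun j => orderStat x j ≤ q).card : ℝ) := by
    rw [← sum_comp_orderStat]
    simp [Set.indicator_apply]
  rw [hsum, Nat.cast_lt]
  constructor
  · intro h
    have hsub : Finset.Iic i ⊆ Finset.univ.filter fun j => orderStat x j ≤ q := fun j hj => by
      simpa using (orderStat_monotone x (Finset.mem_Iic.1 hj)).trans h
    have := Finset.card_le_card hsub
    rw [Fin.card_Iic] at this
    omega
  · intro h
    by_contra hlt
    have hsub : (Finset.univ.filter fun j => orderStat x j ≤ q) ⊆ Finset.Iio i := fun j hj => by
      rw [Finset.mem_Iio]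
      by_contra hij
      exact hlt ((orderStat_monotone x (not_lt.1 hij)).trans (Finset.mem_filter.1 hj).2)
    have := Finset.card_le_card hsub
    rw [Fin.card_Iio] at this
    omega

/-- A Markov-type bound for order statistics in terms of the empirical absolute moment. -/
theorem abs_orderStat_rpow_mul_le {n : ℕ} (x : Fin n → ℝ) {κ C : ℝ} (hκ : 0 < κ)
    (hC : ∑ j, |x j| ^ κ ≤ C * n) (i : Fin n) :
    |orderStat x i| ^ κ *
      ((((i : ℕ) : ℝ) + 1) / ((n : ℝ) + 1) * (1 - (((i : ℕ) : ℝ) + 1) / ((n : ℝ) + 1))) ≤ C := by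
  have hin : (((i : ℕ) : ℝ) + 1) ≤ n := by exact_mod_cast i.2
  have hi0 : (0 : ℝ) ≤ ((i : ℕ) : ℝ) := Nat.cast_nonneg _
  set a := |orderStat x i| ^ κ
  have ha0 : 0 ≤ a := by positivity
  -- If the order statistic is nonnegative, all values above it are at least as large in modulus;
  -- otherwise all values below it are.
  have key : (n - ((i : ℕ) : ℝ)) * a ≤ C * n ∨ (((i : ℕ) : ℝ) + 1) * a ≤ C * n := by
    rw [← sum_comp_orderStat x fun y => |y| ^ κ] at hC
    have hle : ∀ s : Finset (Fin n), (∀ j ∈ s, |orderStat x i| ≤ |orderStat x j|) →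
        (s.card : ℝ) * a ≤ C * n := fun s hs => by
      calc (s.card : ℝ) * a = ∑ _j ∈ s, a := by simp
        _ ≤ ∑ j ∈ s, |orderStat x j| ^ κ := Finset.sum_le_sum fun j hj =>
            Real.rpow_le_rpow (abs_nonneg _) (hs j hj) hκ.le
        _ ≤ ∑ j, |orderStat x j| ^ κ :=
            Finset.sum_le_sum_of_subset_of_nonneg (Finset.subset_univ _)
              fun _ _ _ => by positivity
        _ ≤ C * n := hC
    rcases le_total 0 (orderStat x i) with h0 | h0
    · left
      have := hle (Finset.Ici i) fun j hj =>
        abs_le_abs_of_nonneg h0 (orderStat_monotone x (Finset.mem_Ici.1 hj))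
      rwa [Fin.card_Ici, Nat.cast_sub i.2.le] at this
    · right
      have := hle (Finset.Iic i) fun j hj =>
        abs_le_abs_of_nonpos h0 (orderStat_monotone x (Finset.mem_Iic.1 hj))
      rwa [Fin.card_Iic, Nat.cast_add, Nat.cast_one] at this
  have hn : (0 : ℝ) < n := by linarith
  have hw : ∀ u v : ℝ, 0 ≤ u → u ≤ n + 1 → 0 ≤ v → v * a ≤ C * n →
      a * (u / ((n : ℝ) + 1) * (v / ((n : ℝ) + 1))) ≤ C := by
    intro u v hu hun hv h
    have hC0 : 0 ≤ C := by
      by_contra hneg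
      nlinarith [mul_nonneg hv ha0]
    have h1 : u / ((n : ℝ) + 1) ≤ 1 := (div_le_one (by linarith)).2 hun
    have h2 : v * a / ((n : ℝ) + 1) ≤ C := by
      rw [div_le_iff₀ (by linarith)]
      linarith
    have h3 : 0 ≤ v * a / ((n : ℝ) + 1) := by positivity
    calc a * (u / ((n : ℝ) + 1) * (v / ((n : ℝ) + 1)))
        = u / ((n : ℝ) + 1) * (v * a / ((n : ℝ) + 1)) := by ring
      _ ≤ 1 * (v * a / ((n : ℝ) + 1)) := mul_le_mul_of_nonneg_right h1 h3
      _ ≤ C := by linarith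
  have hcompl : 1 - (((i : ℕ) : ℝ) + 1) / ((n : ℝ) + 1) = (n - ((i : ℕ) : ℝ)) / ((n : ℝ) + 1) := by
    field_simp
    ring
  rw [hcompl]
  rcases key with h | h
  · exact hw _ _ (by linarith) (by linarith) (by linarith) h
  · rw [mul_comm (_ / _) (_ / _)]
    exact hw _ _ (by linarith) (by linarith) (by linarith) h

/-! ### The L-statistic as an integral -/

/-- The integral over the unit interval of a step function with `n` steps of equal length. -/
theorem integral_natFloor_mul (g : ℕ → ℝ) {n : ℕ} (hn : 0 < n) :
    ∫ t in Ioo (0 : ℝ) 1, g ⌊(n : ℝ) * t⌋₊ = (1 / (n : ℝ)) * ∑ i ∈ Finset.range n, g i := by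
  have hn' : (0 : ℝ) < n := by exact_mod_cast hn
  have hcongr : ∀ k : ℕ, ∀ t ∈ Ioo (k : ℝ) ((k + 1 : ℕ) : ℝ), g k = g ⌊t⌋₊ := fun k t ht => by
    rw [(Nat.floor_eq_iff (k.cast_nonneg.trans ht.1.le)).2 ⟨ht.1.le, by simpa using ht.2⟩]
  have hk : ∀ k : ℕ, ((k : ℝ)) ≤ ((k + 1 : ℕ) : ℝ) := fun k => by simp
  have hint : ∀ k : ℕ, IntervalIntegrable (fun t : ℝ => g ⌊t⌋₊) volume (k : ℝ) ((k + 1 : ℕ) : ℝ) := by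
    intro k
    rw [intervalIntegrable_iff_integrableOn_Ioo_of_le (hk k)]
    exact IntegrableOn.congr_fun (f := fun _ => g k)
      (integrableOn_const (by simp)) (hcongr k) measurableSet_Ioo
  have hval : ∀ k : ℕ, ∫ t in (k : ℝ)..((k + 1 : ℕ) : ℝ), g ⌊t⌋₊ = g k := fun k => by
    rw [intervalIntegral.integral_of_le (hk k), integral_Ioc_eq_integral_Ioo,
      ← setIntegral_congr_fun measurableSet_Ioo (hcongr k)]
    simp
  rw [← integral_Ioc_eq_integral_Ioo, ← intervalIntegral.integral_of_le zero_le_one,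
    intervalIntegral.integral_comp_mul_left (fun t => g ⌊t⌋₊) hn'.ne', mul_zero, mul_one,
    ← Nat.cast_zero,
    ← intervalIntegral.sum_integral_adjacent_intervals (a := fun k : ℕ => (k : ℝ))
      (fun k _ => hint k)]
  rw [Finset.sum_congr rfl fun k _ => hval k, smul_eq_mul, one_div]

/-- The summands of the L-statistic, extended by zero to all indices. -/
noncomputable def lSummand (J : ℝ → ℝ) (x : ℕ → ℝ) (n i : ℕ) : ℝ :=
  if h : i < n then
    J ((i + 1 : ℝ) / ((n : ℝ) + 1)) * orderStat (fun j : Fin n => x j) ⟨i, h⟩ else 0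

theorem lStatistic_eq_integral (J : ℝ → ℝ) (x : ℕ → ℝ) {n : ℕ} (hn : 0 < n) :
    lStatistic J x n = ∫ t in Ioo (0 : ℝ) 1, lSummand J x n ⌊(n : ℝ) * t⌋₊ := by
  rw [integral_natFloor_mul _ hn, lStatistic, ← Fin.sum_univ_eq_sum_range]
  simp [lSummand]

theorem natFloor_mul_lt {n : ℕ} (hn : 0 < n) {t : ℝ} (ht : t ∈ Ioo (0 : ℝ) 1) :
    ⌊(n : ℝ) * t⌋₊ < n := by
  have hn' : (0 : ℝ) < n := by exact_mod_cast hn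
  rw [Nat.floor_lt (mul_nonneg hn'.le ht.1.le)]
  nlinarith [ht.2]

/-! ### Quantile functions and empirical quantiles -/

section Quantile

variable (ν : Measure ℝ)

theorem bddBelow_setOf_le_cdf {t : ℝ} (ht : 0 < t) : BddBelow {x : ℝ | t ≤ cdf ν x} := by
  obtain ⟨a, ha⟩ := ((tendsto_cdf_atBot ν).eventually (gt_mem_nhds ht)).exists
  refine ⟨a, fun x hx => ?_⟩
  by_contra hlt
  exact absurd (monotone_cdf ν (not_le.1 hlt).le) (not_le.2 (lt_of_lt_of_le ha hx))

theorem nonempty_setOf_le_cdf {t : ℝ} (ht : t < 1) : {x : ℝ | t ≤ cdf ν x}.Nonempty := by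
  obtain ⟨a, ha⟩ := ((tendsto_cdf_atTop ν).eventually (lt_mem_nhds ht)).exists
  exact ⟨a, ha.le⟩

theorem cdf_lt_of_lt_quantileFn {t q : ℝ} (ht : 0 < t) (hq : q < quantileFn ν t) :
    cdf ν q < t := by
  by_contra h
  exact absurd (csInf_le (bddBelow_setOf_le_cdf ν ht) (not_lt.1 h)) (not_le.2 hq)

theorem le_cdf_of_quantileFn_lt {t q : ℝ} (ht : t < 1) (hq : quantileFn ν t < q) :
    t ≤ cdf ν q := by
  obtain ⟨x, hx, hxq⟩ := exists_lt_of_csInf_lt (nonempty_setOf_le_cdf ν ht) hq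
  exact le_trans hx (monotone_cdf ν hxq.le)

theorem quantileFn_monotoneOn : MonotoneOn (quantileFn ν) (Ioo (0 : ℝ) 1) :=
  fun _ hs _ ht hst => csInf_le_csInf (bddBelow_setOf_le_cdf ν hs.1)
    (nonempty_setOf_le_cdf ν ht.2) fun _ hx => le_trans hst hx

theorem ae_continuousWithinAt_quantileFn :
    ∀ᵐ t ∂(volume.restrict (Ioo (0 : ℝ) 1)),
      ContinuousWithinAt (quantileFn ν) (Ioo (0 : ℝ) 1) t := by
  rw [ae_restrict_iff' measurableSet_Ioo]
  filter_upwards [((quantileFn_monotoneOn ν).countable_not_continuousWithinAt).ae_notMem volume]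
    with t ht hmem
  by_contra h
  exact ht ⟨hmem, h⟩

/-- The empirical quantile function converges at every continuity point of the quantile
function, if the empirical distribution function converges at every rational. -/
theorem tendsto_orderStat_quantileFn {x : ℕ → ℝ}
    (hx : ∀ q : ℚ, Tendsto (fun n : ℕ =>
      (∑ j ∈ Finset.range n, (Iic (q : ℝ)).indicator (fun _ => (1 : ℝ)) (x j)) / n)
      atTop (𝓝 (cdf ν q)))
    {t : ℝ} (ht : t ∈ Ioo (0 : ℝ) 1)
    (hcont : ContinuousWithinAt (quantileFn ν) (Ioo (0 : ℝ) 1) t) (y : ℕ → ℝ)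
    (hy : ∀ n : ℕ, ∀ h : ⌊(n : ℝ) * t⌋₊ < n,
      y n = orderStat (fun j : Fin n => x j) ⟨⌊(n : ℝ) * t⌋₊, h⟩) :
    Tendsto y atTop (𝓝 (quantileFn ν t)) := by
  have hsum : ∀ n : ℕ, ∀ q : ℝ,
      ∑ j ∈ Finset.range n, (Iic q).indicator (fun _ => (1 : ℝ)) (x j) =
        ∑ j : Fin n, (Iic q).indicator (fun _ => (1 : ℝ)) (x j) := fun n q =>
    (Fin.sum_univ_eq_sum_range (fun j => (Iic q).indicator (fun _ => (1 : ℝ)) (x j)) n).symm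
  rw [tendsto_order]
  constructor
  · intro a ha
    obtain ⟨q, haq, hq⟩ := exists_rat_btwn ha
    filter_upwards [(hx q).eventually (gt_mem_nhds (cdf_lt_of_lt_quantileFn ν ht.1 hq)),
      eventually_gt_atTop 0] with n hn hn0
    have hn' : (0 : ℝ) < n := by exact_mod_cast hn0
    rw [hy n (natFloor_mul_lt hn0 ht)]
    refine haq.trans ?_
    by_contra hle
    have h1 := (orderStat_le_iff _ _ _).1 (not_lt.1 hle)
    rw [← hsum n q] at h1
    rw [div_lt_iff₀ hn'] at hn
    -- Integrality of the count turns $c<nt$ into $c\le\lfloor nt\rfloor$.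
    obtain ⟨c, hc⟩ : ∃ c : ℕ,
        ∑ j ∈ Finset.range n, (Iic (q : ℝ)).indicator (fun _ => (1 : ℝ)) (x j) = c := by
      classical
      simp only [Set.indicator_apply, Finset.sum_boole]
      exact ⟨_, rfl⟩
    rw [hc] at h1 hn
    have h2 : c ≤ ⌊(n : ℝ) * t⌋₊ := Nat.le_floor (by linarith)
    exact absurd (Nat.cast_lt.1 h1) (not_lt.2 h2)
  · intro b hb
    obtain ⟨q, hq, hqb⟩ := exists_rat_btwn hb
    -- Continuity at $t$ is needed only here: a level $s>t$ with quantile below $q$ gives the strict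
    -- inequality $t<F(q)$.
    obtain ⟨s, hts, hs1, hsq⟩ : ∃ s, t < s ∧ s < 1 ∧ quantileFn ν s < q := by
      have h1 : ∀ᶠ s in 𝓝[>] t, s < 1 := nhdsWithin_le_nhds (gt_mem_nhds ht.2)
      have h2 : Tendsto (quantileFn ν) (𝓝[>] t) (𝓝 (quantileFn ν t)) :=
        (hcont.continuousAt (Ioo_mem_nhds ht.1 ht.2)).tendsto.mono_left nhdsWithin_le_nhds
      obtain ⟨s, hs⟩ := (eventually_mem_nhdsWithin.and
        (h1.and (h2.eventually (gt_mem_nhds hq)))).exists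
      exact ⟨s, hs.1, hs.2.1, hs.2.2⟩
    filter_upwards [(hx q).eventually
        (lt_mem_nhds (hts.trans_le (le_cdf_of_quantileFn_lt ν hs1 hsq))),
      eventually_gt_atTop 0] with n hn hn0
    have hn' : (0 : ℝ) < n := by exact_mod_cast hn0
    rw [hy n (natFloor_mul_lt hn0 ht)]
    refine lt_of_le_of_lt ?_ hqb
    rw [orderStat_le_iff, ← hsum n q]
    rw [lt_div_iff₀ hn'] at hn
    have := Nat.floor_le (mul_nonneg hn'.le ht.1.le)
    exact lt_of_le_of_lt this (by linarith)

end Quantile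

/-! ### Weights and the integrable majorant -/

/-- Follows from $u\ge t/2$ and $1-u\ge(1-t)/2$, which hold for every $n\ge1$. -/
theorem quarter_mul_le_and_mem_Ioo {n : ℕ} (hn : 0 < n) {t : ℝ} (ht : t ∈ Ioo (0 : ℝ) 1) {u : ℝ}
    (hu : u = ((⌊(n : ℝ) * t⌋₊ : ℝ) + 1) / ((n : ℝ) + 1)) :
    u ∈ Ioo (0 : ℝ) 1 ∧ t * (1 - t) / 4 ≤ u * (1 - u) := by
  have hn' : (1 : ℝ) ≤ n := by exact_mod_cast hn
  have hlt : ((⌊(n : ℝ) * t⌋₊ : ℝ)) + 1 ≤ n := by exact_mod_cast natFloor_mul_lt hn ht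
  have hfl := Nat.floor_le (mul_nonneg (by linarith : (0 : ℝ) ≤ n) ht.1.le)
  have hfl' := Nat.lt_floor_add_one ((n : ℝ) * t)
  have hf0 : (0 : ℝ) ≤ (⌊(n : ℝ) * t⌋₊ : ℝ) := Nat.cast_nonneg _
  have h1 : t / 2 ≤ u := by
    rw [hu, le_div_iff₀ (by linarith)]
    nlinarith [mul_nonneg ht.1.le (by linarith : (0 : ℝ) ≤ n - 1)]
  have h2 : (1 - t) / 2 ≤ 1 - u := by
    have : 1 - u = (n - (⌊(n : ℝ) * t⌋₊ : ℝ)) / ((n : ℝ) + 1) := by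
      rw [hu]
      field_simp
      ring
    rw [this, le_div_iff₀ (by linarith)]
    nlinarith [mul_nonneg (by linarith [ht.2] : 0 ≤ 1 - t) (by linarith : (0 : ℝ) ≤ n - 1)]
  refine ⟨⟨by linarith [ht.1], by linarith [ht.2]⟩, ?_⟩
  have := mul_le_mul h1 h2 (by linarith [ht.2]) (by linarith [ht.1])
  linarith

theorem tendsto_natFloor_mul_add_one_div {t : ℝ} (ht : 0 ≤ t) :
    Tendsto (fun n : ℕ => ((⌊(n : ℝ) * t⌋₊ : ℝ) + 1) / ((n : ℝ) + 1)) atTop (𝓝 t) := by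
  have hinv : Tendsto (fun n : ℕ => 1 / ((n : ℝ) + 1)) atTop (𝓝 0) :=
    tendsto_one_div_add_atTop_nhds_zero_nat
  have hlow : Tendsto (fun n : ℕ => t - t * (1 / ((n : ℝ) + 1))) atTop (𝓝 t) := by
    simpa using (hinv.const_mul t).const_sub t
  have hup : Tendsto (fun n : ℕ => t + 1 / ((n : ℝ) + 1)) atTop (𝓝 t) := by
    simpa using hinv.const_add t
  refine tendsto_of_tendsto_of_tendsto_of_le_of_le hlow hup (fun n => ?_) fun n => ?_
  · have hn : (0 : ℝ) < (n : ℝ) + 1 := by positivity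
    have := (Nat.lt_floor_add_one ((n : ℝ) * t)).le
    change t - t * (1 / ((n : ℝ) + 1)) ≤ _
    have heq : t - t * (1 / ((n : ℝ) + 1)) = (n * t) / ((n : ℝ) + 1) := by
      field_simp
      ring
    rw [heq]
    gcongr
  · have hn : (0 : ℝ) < (n : ℝ) + 1 := by positivity
    have := Nat.floor_le (mul_nonneg (n.cast_nonneg : (0 : ℝ) ≤ n) ht)
    change _ ≤ t + 1 / ((n : ℝ) + 1)
    rw [div_le_iff₀ hn, add_mul, div_mul_cancel₀ _ hn.ne']
    linarith

/-- One of the factors $t$, $1-t$ is at least $1/2$, which leaves a single integrable endpoint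
singularity. -/
theorem integrableOn_mul_one_sub_rpow {a : ℝ} (ha : -1 < a) (ha0 : a ≤ 0) :
    IntegrableOn (fun t : ℝ => (t * (1 - t)) ^ a) (Ioo 0 1) := by
  have h1 : IntervalIntegrable (fun t : ℝ => t ^ a) volume 0 1 :=
    intervalIntegral.intervalIntegrable_rpow' ha
  have h2 : IntervalIntegrable (fun t : ℝ => (1 - t) ^ a) volume 0 1 := by
    simpa using (h1.comp_sub_left 1).symm
  have h3 := (h1.add h2).const_mul ((1 / 2 : ℝ) ^ a)
  rw [intervalIntegrable_iff_integrableOn_Ioo_of_le zero_le_one] at h3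
  refine Integrable.mono' h3 (Measurable.aestronglyMeasurable (by fun_prop)) ?_
  rw [ae_restrict_iff' measurableSet_Ioo]
  refine Eventually.of_forall fun t ht => ?_
  have ht1 : 0 < 1 - t := sub_pos.2 ht.2
  have hp : 0 < t * (1 - t) := mul_pos ht.1 ht1
  have hp1 := Real.rpow_nonneg ht.1.le a
  have hp2 := Real.rpow_nonneg ht1.le a
  have hh : (0 : ℝ) ≤ (1 / 2 : ℝ) ^ a := by positivity
  rw [Real.norm_of_nonneg (Real.rpow_nonneg hp.le _)]
  change _ ≤ (1 / 2 : ℝ) ^ a * (t ^ a + (1 - t) ^ a)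
  rcases le_total t (1 / 2) with h | h
  · calc (t * (1 - t)) ^ a ≤ (1 / 2 * t) ^ a :=
          Real.rpow_le_rpow_of_nonpos (by linarith [ht.1]) (by nlinarith [ht.1]) ha0
      _ = (1 / 2 : ℝ) ^ a * t ^ a := Real.mul_rpow (by norm_num) ht.1.le
      _ ≤ _ := mul_le_mul_of_nonneg_left (by linarith) hh
  · calc (t * (1 - t)) ^ a ≤ (1 / 2 * (1 - t)) ^ a :=
          Real.rpow_le_rpow_of_nonpos (by linarith) (by nlinarith) ha0
      _ = (1 / 2 : ℝ) ^ a * (1 - t) ^ a := Real.mul_rpow (by norm_num) ht1.le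
      _ ≤ _ := mul_le_mul_of_nonneg_left (by linarith) hh

/-! ### Dominated convergence and the strong law -/

/-- The deterministic part of the strong law: convergence of the L-statistic along a sequence
whose empirical distribution functions converge and whose empirical moments are bounded. -/
theorem integrableOn_and_tendsto_lStatistic (ν : Measure ℝ) {x : ℕ → ℝ} {κ γ M C : ℝ}
    (hκ : 0 < κ) (hγ : 0 < γ) (hM : 0 < M) {J : ℝ → ℝ}
    (hbound : ∀ t ∈ Ioo (0 : ℝ) 1, |J t| ≤ M * (t * (1 - t)) ^ (-1 + 1 / κ + γ))
    (hcont : ∀ᵐ t ∂(volume.restrict (Ioo (0 : ℝ) 1)), ContinuousWithinAt J (Ioo (0 : ℝ) 1) t)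
    (hx : ∀ q : ℚ, Tendsto (fun n : ℕ =>
      (∑ j ∈ Finset.range n, (Iic (q : ℝ)).indicator (fun _ => (1 : ℝ)) (x j)) / n)
      atTop (𝓝 (cdf ν q)))
    (hC : ∀ n : ℕ, (∑ j ∈ Finset.range n, |x j| ^ κ) / n ≤ C) :
    IntegrableOn (fun t => J t * quantileFn ν t) (Ioo (0 : ℝ) 1) ∧
      Tendsto (fun n : ℕ => lStatistic J x n) atTop
        (𝓝 (∫ t in Ioo (0 : ℝ) 1, J t * quantileFn ν t)) := by
  -- At $n=0$ the average is $0/0=0$.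
  have hC0 : 0 ≤ C := by simpa using hC 0
  -- Capping $\gamma$ at $1$ makes the exponent nonpositive, so that a lower bound on $u(1-u)$
  -- bounds its power from above.
  set a := -1 + min γ 1 with ha
  have ha1 : -1 < a := by
    have : 0 < min γ 1 := lt_min hγ one_pos
    linarith
  have ha0 : a ≤ 0 := by linarith [min_le_right γ 1]
  set K := M * C ^ (1 / κ) * (1 / 4 : ℝ) ^ a with hK
  set f : ℕ → ℝ → ℝ := fun n t => lSummand J x n ⌊(n : ℝ) * t⌋₊ with hf
  have hmeas : ∀ n, AEStronglyMeasurable (f n) (volume.restrict (Ioo (0 : ℝ) 1)) := fun n =>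
    (Measurable.comp (measurable_of_countable (lSummand J x n))
      (Nat.measurable_floor.comp (measurable_const_mul (n : ℝ)))).aestronglyMeasurable
  have hint : Integrable (fun t : ℝ => K * (t * (1 - t)) ^ a) (volume.restrict (Ioo (0 : ℝ) 1)) :=
    (integrableOn_mul_one_sub_rpow ha1 ha0).const_mul K
  have hdom : ∀ n, ∀ᵐ t ∂(volume.restrict (Ioo (0 : ℝ) 1)),
      ‖f n t‖ ≤ K * (t * (1 - t)) ^ a := by
    intro n
    rw [ae_restrict_iff' measurableSet_Ioo]
    refine Eventually.of_forall fun t ht => ?_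
    have hp : 0 < t * (1 - t) := mul_pos ht.1 (sub_pos.2 ht.2)
    rcases Nat.eq_zero_or_pos n with rfl | hn
    · simp only [hf, lSummand, Nat.not_lt_zero, dite_false, norm_zero]
      positivity
    have hlt := natFloor_mul_lt hn ht
    set u : ℝ := ((⌊(n : ℝ) * t⌋₊ : ℝ) + 1) / ((n : ℝ) + 1) with hu
    obtain ⟨hu01, hquarter⟩ := quarter_mul_le_and_mem_Ioo hn ht hu
    set y := orderStat (fun j : Fin n => x j) ⟨⌊(n : ℝ) * t⌋₊, hlt⟩ with hy
    have hfy : f n t = J u * y := by simp only [hf, lSummand, dif_pos hlt, hu, hy]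
    set w := u * (1 - u)
    have hw0 : 0 < w := mul_pos hu01.1 (sub_pos.2 hu01.2)
    have hw1 : w ≤ 1 := by nlinarith [hu01.1, hu01.2]
    have hmom : |y| ^ κ * w ≤ C := by
      have hCn : ∑ j : Fin n, |x j| ^ κ ≤ C * n := by
        have := hC n
        rwa [div_le_iff₀ (by exact_mod_cast hn),
          ← Fin.sum_univ_eq_sum_range (fun j => |x j| ^ κ)] at this
      exact abs_orderStat_rpow_mul_le (fun j : Fin n => x j) hκ hCn ⟨_, hlt⟩
    have hyle : |y| ≤ C ^ (1 / κ) * w ^ (-(1 / κ)) := by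
      have h1 : |y| ^ κ ≤ C / w := (le_div_iff₀ hw0).2 hmom
      have h2 := Real.rpow_le_rpow (by positivity) h1 (by positivity : 0 ≤ 1 / κ)
      rwa [← Real.rpow_mul (abs_nonneg _), mul_one_div_cancel hκ.ne', Real.rpow_one,
        Real.div_rpow hC0 hw0.le, div_eq_mul_inv, ← Real.rpow_neg hw0.le] at h2
    rw [hfy, norm_mul, Real.norm_eq_abs, Real.norm_eq_abs]
    calc |J u| * |y| ≤ (M * w ^ (-1 + 1 / κ + γ)) * (C ^ (1 / κ) * w ^ (-(1 / κ))) :=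
          mul_le_mul (hbound u hu01) hyle (abs_nonneg _) (by positivity)
      _ = M * C ^ (1 / κ) * w ^ (-1 + γ) := by
          have : -1 + γ = (-1 + 1 / κ + γ) + -(1 / κ) := by ring
          rw [this, Real.rpow_add hw0 (-1 + 1 / κ + γ)]
          ring
      _ ≤ M * C ^ (1 / κ) * w ^ a := by
          refine mul_le_mul_of_nonneg_left ?_ (by positivity)
          exact Real.rpow_le_rpow_of_exponent_ge hw0 hw1 (by linarith [min_le_left γ 1])
      _ ≤ M * C ^ (1 / κ) * ((1 / 4) * (t * (1 - t))) ^ a := by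
          refine mul_le_mul_of_nonneg_left ?_ (by positivity)
          exact Real.rpow_le_rpow_of_nonpos (by positivity) (by linarith) ha0
      _ = K * (t * (1 - t)) ^ a := by
          rw [Real.mul_rpow (by norm_num) hp.le, hK]
          ring
  have hlim : ∀ᵐ t ∂(volume.restrict (Ioo (0 : ℝ) 1)),
      Tendsto (fun n => f n t) atTop (𝓝 (J t * quantileFn ν t)) := by
    filter_upwards [hcont, ae_continuousWithinAt_quantileFn ν, ae_restrict_mem measurableSet_Ioo]
      with t hJ hQ ht
    have hJlim : Tendsto (fun n : ℕ => J (((⌊(n : ℝ) * t⌋₊ : ℝ) + 1) / ((n : ℝ) + 1))) atTop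
        (𝓝 (J t)) :=
      ((hJ.continuousAt (Ioo_mem_nhds ht.1 ht.2)).tendsto).comp
        (tendsto_natFloor_mul_add_one_div ht.1.le)
    have hQlim := tendsto_orderStat_quantileFn ν hx ht hQ
      (fun n => if h : ⌊(n : ℝ) * t⌋₊ < n then
        orderStat (fun j : Fin n => x j) ⟨⌊(n : ℝ) * t⌋₊, h⟩ else 0)
      (fun n h => dif_pos h)
    refine (hJlim.mul hQlim).congr' ?_
    filter_upwards [eventually_gt_atTop 0] with n hn
    simp only [hf, lSummand, dif_pos (natFloor_mul_lt hn ht)]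
  refine ⟨?_, ?_⟩
  · refine Integrable.mono' hint (aestronglyMeasurable_of_tendsto_ae atTop hmeas hlim) ?_
    filter_upwards [hlim, ae_all_iff.2 hdom] with t h1 h2
    exact le_of_tendsto h1.norm (Eventually.of_forall h2)
  · refine (tendsto_integral_of_dominated_convergence _ hmeas hint hdom hlim).congr' ?_
    filter_upwards [eventually_gt_atTop 0] with n hn
    exact (lStatistic_eq_integral J x hn).symm

/-- The strong law of large numbers for a measurable function of the terms of the sequence. -/
theorem ae_tendsto_average_comp {Ω Ω' : Type*} [MeasurableSpace Ω] [MeasurableSpace Ω']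
    {P : Measure Ω} {P' : Measure Ω'} {X : Ω' → ℝ} {Xs : ℕ → Ω → ℝ}
    (hindep : iIndepFun Xs P) (hident : ∀ i, IdentDistrib (Xs i) X P P')
    {u : ℝ → ℝ} (hu : Measurable u) (hint : Integrable (fun ω => u (X ω)) P') :
    ∀ᵐ ω ∂P, Tendsto (fun n : ℕ => (∑ i ∈ Finset.range n, u (Xs i ω)) / n) atTop
      (𝓝 (∫ ω, u (X ω) ∂P')) := by
  have hid : ∀ i, IdentDistrib (fun ω => u (Xs i ω)) (fun ω => u (X ω)) P P' := fun i =>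
    (hident i).comp hu
  have := strong_law_ae_real (fun i ω => u (Xs i ω)) ((hid 0).integrable_iff.2 hint)
    (fun i j hij => (hindep.indepFun hij).comp hu hu) (fun i => (hid i).trans (hid 0).symm)
  rwa [(hid 0).integral_eq] at this

theorem mainTheorem7
    {Ω Ω' : Type*} [MeasurableSpace Ω] [MeasurableSpace Ω']
    (P : Measure Ω) [IsProbabilityMeasure P] (P' : Measure Ω') [IsProbabilityMeasure P']
    (X : Ω' → ℝ) (Xs : ℕ → Ω → ℝ)
    (hindep : iIndepFun Xs P) (hident : ∀ i, IdentDistrib (Xs i) X P P')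
    (κ γ M : ℝ) (hκ : 0 < κ) (hγ : 0 < γ) (hM : 0 < M)
    (hmoment : Integrable (fun ω => |X ω| ^ κ) P')
    (J : ℝ → ℝ)
    (hbound : ∀ t ∈ Ioo (0 : ℝ) 1, |J t| ≤ M * (t * (1 - t)) ^ (-1 + 1 / κ + γ))
    (hcont : ∀ᵐ t ∂(volume.restrict (Ioo (0 : ℝ) 1)), ContinuousWithinAt J (Ioo (0 : ℝ) 1) t) :
    IntegrableOn (fun t => J t * quantileFn (P'.map X) t) (Ioo (0 : ℝ) 1) ∧
      ∀ᵐ ω ∂P, Tendsto (fun n : ℕ => lStatistic J (fun j => Xs j ω) n) atTop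
        (𝓝 (∫ t in Ioo (0 : ℝ) 1, J t * quantileFn (P'.map X) t)) := by
  have hX : AEMeasurable X P' := (hident 0).aemeasurable_snd
  have : IsProbabilityMeasure (P'.map X) := Measure.isProbabilityMeasure_map hX
  -- Restricting to rational $q$ leaves countably many null sets to discard.
  have hcdf : ∀ q : ℚ, ∀ᵐ ω ∂P, Tendsto (fun n : ℕ =>
      (∑ j ∈ Finset.range n, (Iic (q : ℝ)).indicator (fun _ => (1 : ℝ)) (Xs j ω)) / n)
      atTop (𝓝 (cdf (P'.map X) q)) := fun q => by
    have hm : Measurable ((Iic (q : ℝ)).indicator fun _ => (1 : ℝ)) :=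
      measurable_const.indicator measurableSet_Iic
    have hi : Integrable ((Iic (q : ℝ)).indicator fun _ => (1 : ℝ)) (P'.map X) :=
      (integrable_const 1).indicator measurableSet_Iic
    have h := ae_tendsto_average_comp hindep hident hm (hi.comp_aemeasurable hX)
    rwa [← integral_map hX hm.aestronglyMeasurable, integral_indicator measurableSet_Iic,
      setIntegral_const, smul_eq_mul, mul_one, ← cdf_eq_real] at h
  have hmom := ae_tendsto_average_comp hindep hident
    (u := fun y => |y| ^ κ) (by fun_prop) hmoment
  have hall : ∀ᵐ ω ∂P, IntegrableOn (fun t => J t * quantileFn (P'.map X) t) (Ioo (0 : ℝ) 1) ∧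
      Tendsto (fun n : ℕ => lStatistic J (fun j => Xs j ω) n) atTop
        (𝓝 (∫ t in Ioo (0 : ℝ) 1, J t * quantileFn (P'.map X) t)) := by
    filter_upwards [ae_all_iff.2 hcdf, hmom] with ω h1 h2
    -- The bound $C$ may depend on $\omega$.
    obtain ⟨C, hC⟩ := h2.bddAbove_range
    exact integrableOn_and_tendsto_lStatistic (P'.map X) hκ hγ hM hbound hcont h1
      fun n => hC ⟨n, rfl⟩
  -- Integrability does not involve $\omega$, so a single good path proves it.
  obtain ⟨ω, hω⟩ := hall.exists
  exact ⟨hω.1, hall.mono fun _ h => h.2⟩
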